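/- Let $n\ge 2$, let $\Omega\subset\mathbb{R}^n$ be a non-empty bounded open Lipschitz set, and let $a\in L^{\infty}(\Omega;\mathbb{R}^n)$. Then there exists $f\in L^1(\Omega)$ such that there is no $u\in W^{1,1}(\Omega;\mathbb{R}^n)$ with $\operatorname{div}u+\langle a,u\rangle=f$ almost everywhere in $\Omega$. Here $\langle\cdot,\cdot\rangle$ is the standard scalar product of $\mathbb{R}^n$, $\operatorname{div}u$ is the weak divergence, no boundary condition is imposed on $u$, and $\Omega$ is called Lipschitz if near each of its boundary points, in suitable orthonormal coordinates, it coincides with the set of points strictly above the graph of a Lipschitz function. -/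

import Mathlib

open MeasureTheory TopologicalSpace
open scoped ENNReal

/-- An open set `Ω ⊆ ℝⁿ` is Lipschitz if, near each of its boundary points and in suitable
orthonormal coordinates (with vertical direction `ν`), it is the set of points lying strictly
above the graph of a Lipschitz function of the horizontal variables, which range over the
hyperplane orthogonal to `ν`. -/
def IsLipschitzSet {n : ℕ} (Ω : Opens (EuclideanSpace ℝ (Fin n))) : Prop :=
  ∀ x ∈ frontier (Ω : Set (EuclideanSpace ℝ (Fin n))),
    ∃ ν : EuclideanSpace ℝ (Fin n), ‖ν‖ = 1 ∧
      ∃ γ : ↥(ℝ ∙ ν)ᗮ → ℝ, (∃ K : NNReal, LipschitzWith K γ) ∧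
        ∃ r : ℝ, 0 < r ∧ ∀ y ∈ Metric.ball x r,
          (y ∈ Ω ↔ γ ((ℝ ∙ ν)ᗮ.orthogonalProjectionOnto y) < inner ℝ ν y)

/-- `h` is the weak partial derivative `∂g/∂xⱼ` on `Ω`: both functions are locally integrable on
`Ω` and `∫_Ω g ∂ⱼφ = - ∫_Ω h φ` for every real test function `φ ∈ C_c^∞(Ω)`. -/
def HasWeakPartialDeriv {n : ℕ} (Ω : Opens (EuclideanSpace ℝ (Fin n))) (j : Fin n)
    (g h : EuclideanSpace ℝ (Fin n) → ℝ) : Prop :=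
  LocallyIntegrableOn g (Ω : Set (EuclideanSpace ℝ (Fin n))) volume ∧
  LocallyIntegrableOn h (Ω : Set (EuclideanSpace ℝ (Fin n))) volume ∧
  ∀ φ : TestFunction Ω ℝ (⊤ : ℕ∞),
    ∫ x in (Ω : Set (EuclideanSpace ℝ (Fin n))),
        g x * fderiv ℝ (φ : EuclideanSpace ℝ (Fin n) → ℝ) x (EuclideanSpace.single j 1)
      = - ∫ x in (Ω : Set (EuclideanSpace ℝ (Fin n))), h x * φ x

/-- `D` is the weak Jacobian matrix of the vector field `u` on `Ω`: `D x i j = ∂uᵢ/∂xⱼ (x)`. -/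
def IsWeakJacobian {n : ℕ} (Ω : Opens (EuclideanSpace ℝ (Fin n)))
    (u : EuclideanSpace ℝ (Fin n) → EuclideanSpace ℝ (Fin n))
    (D : EuclideanSpace ℝ (Fin n) → Matrix (Fin n) (Fin n) ℝ) : Prop :=
  ∀ i j : Fin n, HasWeakPartialDeriv Ω j (fun x => u x i) (fun x => D x i j)

/-- `u ∈ W^{1,p}(Ω; ℝⁿ)`: the field `u` and all its weak first partial derivatives are in `L^p`. -/
def MemSobolevOne {n : ℕ} (Ω : Opens (EuclideanSpace ℝ (Fin n))) (p : ℝ≥0∞)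
    (u : EuclideanSpace ℝ (Fin n) → EuclideanSpace ℝ (Fin n)) : Prop :=
  MemLp u p (volume.restrict (Ω : Set (EuclideanSpace ℝ (Fin n)))) ∧
  ∃ D : EuclideanSpace ℝ (Fin n) → Matrix (Fin n) (Fin n) ℝ, IsWeakJacobian Ω u D ∧
    ∀ i j : Fin n,
      MemLp (fun x => D x i j) p (volume.restrict (Ω : Set (EuclideanSpace ℝ (Fin n))))

/-- `u` is weakly differentiable on `Ω` and `div u + ⟨a, u⟩ = f` almost everywhere on `Ω`, where
`div u` is the trace of the weak Jacobian matrix (which is unique almost everywhere). -/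
def SolvesPerturbedDivEq {n : ℕ} (Ω : Opens (EuclideanSpace ℝ (Fin n)))
    (a : EuclideanSpace ℝ (Fin n) → EuclideanSpace ℝ (Fin n))
    (f : EuclideanSpace ℝ (Fin n) → ℝ)
    (u : EuclideanSpace ℝ (Fin n) → EuclideanSpace ℝ (Fin n)) : Prop :=
  ∃ D : EuclideanSpace ℝ (Fin n) → Matrix (Fin n) (Fin n) ℝ, IsWeakJacobian Ω u D ∧
    ∀ᵐ x ∂(volume.restrict (Ω : Set (EuclideanSpace ℝ (Fin n)))),
      (D x).trace + inner ℝ (a x) (u x) = f x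

/-!
If every `f ∈ L¹(Ω)` were of the form `div u + ⟨a, u⟩` with `u` weakly differentiable, then the
`W^{1,n}` norm would control the supremum norm of test functions supported in a small ball, which
is false in dimension `n ≥ 2`.

Fix a closed ball `B` well inside `Ω`, and let `n' = n / (n - 1)`. A weakly differentiable `u` is in
`L^{n'}(B)`, by the Gagliardo–Nirenberg–Sobolev inequality applied to a cut-off of `u`
(`memLp_restrict_ball`), and so is `⟨a, u⟩` because `a` is bounded. Integration by parts and
Hölder's inequality give, for test functions `φ` supported in `B`,
`|∫ f φ| = |- ∫ ⟨u, ∇φ⟩ + ∫ ⟨a, u⟩ φ| ≤ C(u) (‖∇φ‖_n + ‖φ‖_n)`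
(`SolvesPerturbedDivEq.enorm_integral_mul_le`). Along a sequence of test functions bounded in
`W^{1,n}`, the functionals `f ↦ ∫ f φ` are thus pointwise bounded on `L¹(Ω)`, hence bounded in norm
by the Banach–Steinhaus theorem, and so the test functions are uniformly bounded. But
`exists_spikes` constructs such a sequence which exceeds the harmonic numbers near a point.
-/

/-! ### Local integrability of weakly differentiable functions -/

section Sobolev

open Filter Topology Convolution ContDiff

theorem ContinuousLinearMap.norm_le_sum_norm_apply_single {n : ℕ}
    (L : EuclideanSpace ℝ (Fin n) →L[ℝ] ℝ) :
    ‖L‖ ≤ ∑ j, ‖L (EuclideanSpace.single j 1)‖ := by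
  refine L.opNorm_le_bound (Finset.sum_nonneg fun _ _ => norm_nonneg _) fun w => ?_
  have hw : w = ∑ j, w j • EuclideanSpace.single j (1 : ℝ) := by
    have := (EuclideanSpace.basisFun (Fin n) ℝ).sum_repr w
    simpa using this.symm
  conv_lhs => rw [hw]
  rw [map_sum, Finset.sum_mul]
  refine (norm_sum_le _ _).trans (Finset.sum_le_sum fun j _ => ?_)
  rw [map_smul, norm_smul, mul_comm]
  gcongr
  exact PiLp.norm_apply_le w j

section Mollification

variable {E : Type*} [NormedAddCommGroup E] [NormedSpace ℝ E] [FiniteDimensional ℝ E]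
  [MeasurableSpace E] [BorelSpace E] {μ : Measure E} [μ.IsAddHaarMeasure]

/-- Young's inequality for the convolution of two `L¹` functions. -/
theorem lintegral_enorm_convolution_le {ρ h : E → ℝ} (hρ : AEStronglyMeasurable ρ μ)
    (hh : AEStronglyMeasurable h μ) :
    ∫⁻ x, ‖(ρ ⋆[ContinuousLinearMap.lsmul ℝ ℝ, μ] h) x‖ₑ ∂μ
      ≤ (∫⁻ x, ‖ρ x‖ₑ ∂μ) * ∫⁻ x, ‖h x‖ₑ ∂μ := by
  have hm : AEMeasurable (Function.uncurry fun x t => ‖ρ t‖ₑ * ‖h (x - t)‖ₑ) (μ.prod μ) := by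
    have := (hρ.convolution_integrand (ContinuousLinearMap.lsmul ℝ ℝ) hh (μ := μ)).enorm
    refine this.congr (ae_of_all _ fun p => ?_)
    simp [Function.uncurry, enorm_mul]
  calc ∫⁻ x, ‖(ρ ⋆[ContinuousLinearMap.lsmul ℝ ℝ, μ] h) x‖ₑ ∂μ
      ≤ ∫⁻ x, ∫⁻ t, ‖ρ t‖ₑ * ‖h (x - t)‖ₑ ∂μ ∂μ := by
        refine lintegral_mono fun x => ?_
        rw [convolution_def]
        refine (enorm_integral_le_lintegral_enorm _).trans (lintegral_mono fun t => ?_)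
        simp [enorm_mul]
    _ = ∫⁻ t, ∫⁻ x, ‖ρ t‖ₑ * ‖h (x - t)‖ₑ ∂μ ∂μ := lintegral_lintegral_swap hm
    _ = ∫⁻ t, ‖ρ t‖ₑ * ∫⁻ x, ‖h x‖ₑ ∂μ ∂μ := by
        refine lintegral_congr fun t => ?_
        rw [lintegral_const_mul' _ _ enorm_ne_top, lintegral_sub_right_eq_self (fun x => ‖h x‖ₑ)]
    _ = _ := lintegral_mul_const'' _ hρ.enorm

theorem ContDiffBump.lintegral_enorm_normed (b : ContDiffBump (0 : E)) :
    ∫⁻ x, ‖b.normed μ x‖ₑ ∂μ = 1 := by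
  rw [← ENNReal.ofReal_one, ← b.integral_normed (μ := μ),
    ofReal_integral_eq_lintegral_ofReal b.integrable_normed (ae_of_all _ b.nonneg_normed)]
  exact lintegral_congr fun x => Real.enorm_of_nonneg (b.nonneg_normed x)

/-- Mollification commutes with weak differentiation: if `h` is the weak derivative of `v` in the
direction `w`, then `∂_w (ρ ⋆ v) = ρ ⋆ h`. -/
theorem fderiv_convolution_apply_of_weak {ρ v h : E → ℝ} {w : E} (hρ : ContDiff ℝ ∞ ρ)
    (hρc : HasCompactSupport ρ) (hv : LocallyIntegrable v μ)
    (hvh : ∀ φ : E → ℝ, ContDiff ℝ ∞ φ → HasCompactSupport φ →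
      ∫ x, v x * fderiv ℝ φ x w ∂μ = - ∫ x, h x * φ x ∂μ) (x : E) :
    fderiv ℝ (ρ ⋆[ContinuousLinearMap.lsmul ℝ ℝ, μ] v) x w
      = (ρ ⋆[ContinuousLinearMap.lsmul ℝ ℝ, μ] h) x := by
  have hρ1 : ContDiff ℝ 1 ρ := hρ.of_le (by exact_mod_cast le_top)
  have hcd : Continuous (fderiv ℝ ρ) := hρ1.continuous_fderiv one_ne_zero
  rw [(hρc.hasFDerivAt_convolution_left _ hρ1 hv x).fderiv, convolution_eq_swap,
    ContinuousLinearMap.integral_apply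
      ((HasCompactSupport.convolutionExists_left _ (hρc.fderiv ℝ) hcd hv x).integrable_swap),
    convolution_lsmul_swap]
  have hφ : ContDiff ℝ ∞ fun t => ρ (x - t) := hρ.comp (contDiff_const.sub contDiff_id)
  have hφc : HasCompactSupport fun t => ρ (x - t) :=
    hρc.comp_homeomorph (Homeomorph.subLeft x)
  have hd : ∀ t, fderiv ℝ (fun t => ρ (x - t)) t w = - fderiv ℝ ρ (x - t) w := fun t => by
    have h1 : HasFDerivAt (fun t : E => x - t) (-ContinuousLinearMap.id ℝ E) t := by
      simpa using (hasFDerivAt_id t).const_sub x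
    have := ((hρ1.differentiable one_ne_zero (x - t)).hasFDerivAt).comp t h1
    have e := this.fderiv
    simp only [Function.comp_def] at e
    rw [e]; simp
  have key := hvh _ hφ hφc
  simp only [hd, mul_neg, integral_neg, neg_inj] at key
  simp only [ContinuousLinearMap.precompL_apply, ContinuousLinearMap.lsmul_apply, smul_eq_mul]
  simp only [mul_comm (v _), mul_comm (h _)] at key
  exact key

end Mollification

/-- The Gagliardo–Nirenberg–Sobolev inequality for compactly supported `W^{1,1}` functions, in
qualitative form: apply Mathlib's inequality for `C¹` functions to mollifications, whose gradients
are bounded in `L¹`, and pass to the limit by Fatou's lemma. -/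
theorem memLp_of_weak_fderiv_integrable {n : ℕ} {p : NNReal} (hp : (n : NNReal).HolderConjugate p)
    {v : EuclideanSpace ℝ (Fin n) → ℝ} {h : Fin n → EuclideanSpace ℝ (Fin n) → ℝ}
    (hv : Integrable v) (hvc : HasCompactSupport v) (hh : ∀ j, Integrable (h j))
    (hvh : ∀ j, ∀ φ : EuclideanSpace ℝ (Fin n) → ℝ, ContDiff ℝ ∞ φ → HasCompactSupport φ →
      ∫ x, v x * fderiv ℝ φ x (EuclideanSpace.single j 1) = - ∫ x, h j x * φ x) :
    MemLp v p := by
  refine ⟨hv.aestronglyMeasurable, ?_⟩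
  let b : ℕ → ContDiffBump (0 : EuclideanSpace ℝ (Fin n)) := fun k =>
    { rIn := 1 / ((k : ℝ) + 1) / 2
      rOut := 1 / ((k : ℝ) + 1)
      rIn_pos := half_pos Nat.one_div_pos_of_nat
      rIn_lt_rOut := half_lt_self Nat.one_div_pos_of_nat }
  let vk : ℕ → EuclideanSpace ℝ (Fin n) → ℝ := fun k =>
    (b k).normed volume ⋆[ContinuousLinearMap.lsmul ℝ ℝ, volume] v
  have hlim : ∀ᵐ x, Tendsto (fun k => vk k x) atTop (𝓝 (v x)) := by
    refine ContDiffBump.ae_convolution_tendsto_right_of_locallyIntegrable (K := 2)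
      tendsto_one_div_add_atTop_nhds_zero_nat (Eventually.of_forall fun k => ?_)
      hv.locallyIntegrable
    change 1 / ((k : ℝ) + 1) ≤ 2 * (1 / ((k : ℝ) + 1) / 2)
    linarith
  have hsm : ∀ k, ContDiff ℝ ∞ (vk k) := fun k =>
    (b k).hasCompactSupport_normed.contDiff_convolution_left _ (b k).contDiff_normed
      hv.locallyIntegrable
  have hcs : ∀ k, HasCompactSupport (vk k) := fun k =>
    HasCompactSupport.convolution _ (b k).hasCompactSupport_normed hvc
  have hgrad : ∀ k, eLpNorm (fderiv ℝ (vk k)) 1 volume ≤ ∑ j, ∫⁻ x, ‖h j x‖ₑ := fun k => by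
    rw [eLpNorm_one_eq_lintegral_enorm]
    calc ∫⁻ x, ‖fderiv ℝ (vk k) x‖ₑ
        ≤ ∫⁻ x, ∑ j, ‖((b k).normed volume ⋆[ContinuousLinearMap.lsmul ℝ ℝ, volume] h j) x‖ₑ := by
          refine lintegral_mono fun x => ?_
          simp only [← fderiv_convolution_apply_of_weak (b k).contDiff_normed
            (b k).hasCompactSupport_normed hv.locallyIntegrable (hvh _) x]
          have : ‖fderiv ℝ (vk k) x‖₊
              ≤ ∑ j, ‖fderiv ℝ (vk k) x (EuclideanSpace.single j 1)‖₊ := by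
            refine NNReal.coe_le_coe.1 ?_
            push_cast
            exact (fderiv ℝ (vk k) x).norm_le_sum_norm_apply_single
          simp only [enorm_eq_nnnorm]
          exact_mod_cast this
      _ = ∑ j, ∫⁻ x, ‖((b k).normed volume ⋆[ContinuousLinearMap.lsmul ℝ ℝ, volume] h j) x‖ₑ := by
          refine lintegral_finsetSum' _ fun j _ => ?_
          exact ((b k).integrable_normed.integrable_convolution _ (hh j)).aestronglyMeasurable.enorm
      _ ≤ _ := by
          refine Finset.sum_le_sum fun j _ => ?_
          refine (lintegral_enorm_convolution_le (b k).integrable_normed.aestronglyMeasurable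
            (hh j).aestronglyMeasurable).trans ?_
          rw [(b k).lintegral_enorm_normed, one_mul]
  have hp' : NNReal.HolderConjugate (Module.finrank ℝ (EuclideanSpace ℝ (Fin n))) p := by
    simpa using hp
  have hbound : ∀ k, eLpNorm (vk k) p volume
      ≤ eLpNormLESNormFDerivOneConst (volume : Measure (EuclideanSpace ℝ (Fin n))) p
        * ∑ j, ∫⁻ x, ‖h j x‖ₑ := fun k =>
    (eLpNorm_le_eLpNorm_fderiv_one volume ((hsm k).of_le (by exact_mod_cast le_top)) (hcs k)
      hp').trans (by gcongr; exact hgrad k)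
  refine (Lp.eLpNorm_lim_le_liminf_eLpNorm
    (fun k => (hsm k).continuous.aestronglyMeasurable) v hlim).trans_lt ?_
  have hsum : ∑ j, ∫⁻ x, ‖h j x‖ₑ < ⊤ :=
    ENNReal.sum_lt_top.2 fun j _ => (hh j).hasFiniteIntegral
  refine lt_of_le_of_lt ?_ (ENNReal.mul_lt_top (ENNReal.coe_lt_top
    (r := eLpNormLESNormFDerivOneConst (volume : Measure (EuclideanSpace ℝ (Fin n))) p)) hsum)
  refine liminf_le_of_le (by isBoundedDefault) fun B hB => ?_
  obtain ⟨k, hk⟩ := hB.exists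
  exact hk.trans (hbound k)

theorem MeasureTheory.LocallyIntegrableOn.integrable_mul_of_tsupport_subset {E : Type*}
    [TopologicalSpace E] [T2Space E] [SecondCountableTopology E] [MeasurableSpace E] [BorelSpace E]
    {μ : Measure E} {g η : E → ℝ} {s : Set E} (hg : LocallyIntegrableOn g s μ) (hη : Continuous η)
    (hηc : HasCompactSupport η) (hηs : tsupport η ⊆ s) : Integrable (fun x => η x * g x) μ := by
  rw [← integrableOn_iff_integrable_of_support_subset (s := tsupport η)]
  · exact (hg.integrableOn_compact_subset hηs hηc).continuousOn_mul hη.continuousOn hηc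
  · exact (Function.support_mul_subset_left η g).trans (subset_tsupport η)

/-- The product of a cut-off function and a weakly differentiable function on `Ω` is a compactly
supported `W^{1,1}` function on the whole space, by the Leibniz rule for weak derivatives, hence is
in `L^p` for the exponent `p` conjugate to the dimension. -/
theorem memLp_testFunction_mul {n : ℕ} {p : NNReal} (hp : (n : NNReal).HolderConjugate p)
    {Ω : Opens (EuclideanSpace ℝ (Fin n))}
    {g : EuclideanSpace ℝ (Fin n) → ℝ} {h : Fin n → EuclideanSpace ℝ (Fin n) → ℝ}
    (hgh : ∀ j, HasWeakPartialDeriv Ω j g (h j)) {η : EuclideanSpace ℝ (Fin n) → ℝ}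
    (hη : ContDiff ℝ ∞ η) (hηc : HasCompactSupport η)
    (hηΩ : tsupport η ⊆ Ω) (hg : LocallyIntegrableOn g (Ω : Set (EuclideanSpace ℝ (Fin n)))) :
    MemLp (fun x => η x * g x) p := by
  let e : Fin n → EuclideanSpace ℝ (Fin n) := fun j => EuclideanSpace.single j 1
  let dη : Fin n → EuclideanSpace ℝ (Fin n) → ℝ := fun j x => fderiv ℝ η x (e j)
  have hηd : Differentiable ℝ η := hη.differentiable (by simp)
  have hdη : ∀ j, Continuous (dη j) := fun j =>
    (hη.continuous_fderiv (by simp)).clm_apply continuous_const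
  have hdηc : ∀ j, HasCompactSupport (dη j) := fun j => hηc.fderiv_apply ℝ (e j)
  have hdηΩ : ∀ j, tsupport (dη j) ⊆ Ω := fun j => (tsupport_fderiv_apply_subset ℝ (e j)).trans hηΩ
  have hi0 : Integrable (fun x => η x * g x) :=
    hg.integrable_mul_of_tsupport_subset hη.continuous hηc hηΩ
  have hi1 : ∀ j, Integrable (fun x => dη j x * g x) := fun j =>
    hg.integrable_mul_of_tsupport_subset (hdη j) (hdηc j) (hdηΩ j)
  have hi2 : ∀ j, Integrable (fun x => η x * h j x) := fun j =>
    (hgh j).2.1.integrable_mul_of_tsupport_subset hη.continuous hηc hηΩ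
  refine memLp_of_weak_fderiv_integrable hp hi0 hηc.mul_right
    (h := fun j x => η x * h j x + dη j x * g x) (fun j => (hi2 j).add (hi1 j)) ?_
  intro j φ hφ hφc
  have hφd : Differentiable ℝ φ := hφ.differentiable (by simp)
  let ψ : TestFunction Ω ℝ (⊤ : ℕ∞) :=
    ⟨fun x => η x * φ x, hη.mul hφ, hηc.mul_right, (tsupport_mul_subset_left).trans hηΩ⟩
  have hψ : ∀ x, fderiv ℝ (ψ : EuclideanSpace ℝ (Fin n) → ℝ) x (e j)
      = η x * fderiv ℝ φ x (e j) + φ x * dη j x := fun x => by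
    change fderiv ℝ (fun x => η x * φ x) x (e j) = _
    rw [fderiv_fun_mul (hηd x) (hφd x)]
    simp [dη]
  have hη0 : ∀ x ∉ (Ω : Set (EuclideanSpace ℝ (Fin n))), η x = 0 := fun x hx =>
    image_eq_zero_of_notMem_tsupport fun h => hx (hηΩ h)
  have hdη0 : ∀ x ∉ (Ω : Set (EuclideanSpace ℝ (Fin n))), dη j x = 0 := fun x hx =>
    image_eq_zero_of_notMem_tsupport fun h => hx (hdηΩ j h)
  have key := (hgh j).2.2 ψ
  rw [setIntegral_eq_integral_of_forall_compl_eq_zero,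
    setIntegral_eq_integral_of_forall_compl_eq_zero] at key
  rotate_left
  · intro x hx
    change h j x * (η x * φ x) = 0
    simp [hη0 x hx]
  · intro x hx
    have := hψ x
    simp only [e] at this
    rw [this, hη0 x hx, hdη0 x hx]; simp
  obtain ⟨C, hC⟩ := hφc.exists_bound_of_continuous hφ.continuous
  have hdφ : Continuous fun x => fderiv ℝ φ x (e j) :=
    (hφ.continuous_fderiv (by simp)).clm_apply continuous_const
  obtain ⟨C', hC'⟩ := (hφc.fderiv_apply ℝ (e j)).exists_bound_of_continuous hdφ
  have hj1 : Integrable fun x => η x * g x * fderiv ℝ φ x (e j) :=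
    hi0.mul_bdd hdφ.aestronglyMeasurable (ae_of_all _ hC')
  have hj2 : Integrable fun x => dη j x * g x * φ x :=
    (hi1 j).mul_bdd hφ.continuous.aestronglyMeasurable (ae_of_all _ hC)
  have hj3 : Integrable fun x => η x * h j x * φ x :=
    (hi2 j).mul_bdd hφ.continuous.aestronglyMeasurable (ae_of_all _ hC)
  have e1 : ∫ x, g x * fderiv ℝ (ψ : EuclideanSpace ℝ (Fin n) → ℝ) x (e j)
      = (∫ x, η x * g x * fderiv ℝ φ x (e j)) + ∫ x, dη j x * g x * φ x := by
    rw [← integral_add hj1 hj2]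
    refine integral_congr_ae (ae_of_all _ fun x => ?_)
    simp only [hψ]; ring
  have e2 : ∫ x, (η x * h j x + dη j x * g x) * φ x
      = (∫ x, h j x * ψ x) + ∫ x, dη j x * g x * φ x := by
    have : ∀ x, h j x * ψ x = η x * h j x * φ x := fun x => by
      change h j x * (η x * φ x) = _; ring
    simp only [this]
    rw [← integral_add hj3 hj2]
    refine integral_congr_ae (ae_of_all _ fun x => ?_)
    simp only []; ring
  change ∫ x, η x * g x * fderiv ℝ φ x (e j) = _
  rw [e2]
  have e3 := e1.symm.trans key
  linarith

/-- The local Sobolev embedding `W^{1,1}_loc(Ω) ⊆ L^p(B)`, for a ball `B` whose double lies in `Ω`. -/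
theorem memLp_restrict_ball {n : ℕ} {p : NNReal} (hp : (n : NNReal).HolderConjugate p)
    {Ω : Opens (EuclideanSpace ℝ (Fin n))}
    {g : EuclideanSpace ℝ (Fin n) → ℝ} {h : Fin n → EuclideanSpace ℝ (Fin n) → ℝ}
    (hgh : ∀ j, HasWeakPartialDeriv Ω j g (h j))
    (hg : LocallyIntegrableOn g (Ω : Set (EuclideanSpace ℝ (Fin n))))
    {x₀ : EuclideanSpace ℝ (Fin n)} {r : ℝ} (hr : 0 < r)
    (hΩ : Metric.closedBall x₀ (2 * r) ⊆ Ω) :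
    MemLp g p (volume.restrict (Metric.closedBall x₀ r)) := by
  let η : ContDiffBump x₀ := ⟨r, 2 * r, hr, by linarith⟩
  have := (memLp_testFunction_mul hp hgh (η := η) η.contDiff η.hasCompactSupport
    (η.tsupport_eq.trans_subset hΩ) hg).restrict (Metric.closedBall x₀ r)
  refine this.ae_eq ?_
  filter_upwards [ae_restrict_mem Metric.isClosed_closedBall.measurableSet] with x hx
  rw [η.one_of_mem_closedBall hx, one_mul]

end Sobolev

/-! ### Unbounded test functions with bounded `W^{1,n}` norm -/

section Spikes

open Filter Topology ContDiff

variable {n : ℕ}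

theorem ContDiffBump.fderiv_eq_zero_of_norm_le {E : Type*} [NormedAddCommGroup E] [NormedSpace ℝ E]
    [HasContDiffBump E] (b : ContDiffBump (0 : E)) {y : E} (hy : ‖y‖ ≤ b.rIn) :
    fderiv ℝ b y = 0 := by
  have h1 : b y = 1 := b.one_of_mem_closedBall (by simpa using hy)
  exact IsLocalMax.fderiv_eq_zero (Eventually.of_forall fun z => h1 ▸ b.le_one)

theorem ContDiffBump.fderiv_eq_zero_of_le_norm {E : Type*} [NormedAddCommGroup E] [NormedSpace ℝ E]
    [HasContDiffBump E] (b : ContDiffBump (0 : E)) {y : E} (hy : b.rOut ≤ ‖y‖) :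
    fderiv ℝ b y = 0 := by
  have h1 : b y = 0 := b.zero_of_le_dist (by simpa using hy)
  exact IsLocalMin.fderiv_eq_zero (Eventually.of_forall fun z => h1 ▸ b.nonneg)

theorem eLpNorm_natCast_le_of_forall_enorm_pow_le_sum {E F : Type*} [MeasurableSpace E]
    {μ : Measure E} [NormedAddCommGroup F] (hn : n ≠ 0) {f : E → F} {ι : Type*} (s : Finset ι)
    (B : ι → Set E) (hB : ∀ k ∈ s, MeasurableSet (B k)) (A : ι → ℝ≥0∞)
    (h : ∀ x, ‖f x‖ₑ ^ n ≤ ∑ k ∈ s, (B k).indicator (fun _ => A k) x) :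
    eLpNorm f n μ ≤ (∑ k ∈ s, A k * μ (B k)) ^ (1 / (n : ℝ)) := by
  rw [eLpNorm_eq_lintegral_rpow_enorm_toReal (by simpa using hn) (by simp)]
  simp only [ENNReal.toReal_natCast, ENNReal.rpow_natCast]
  gcongr
  refine (lintegral_mono h).trans ?_
  rw [lintegral_finsetSum' _ fun k hk => (aemeasurable_const.indicator (hB k hk))]
  refine Finset.sum_le_sum fun k hk => ?_
  rw [lintegral_indicator_const (hB k hk)]

/-- In dimension `n ≥ 2` the norm of `W^{1,n}` does not control the supremum norm: the sums
`φ N x = ∑ k < N, b (2 ^ k (x - x₀)) / (k + 1)`, with `b` a bump function, are at least the harmonic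
numbers near `x₀`. The gradients of the summands live on the disjoint dyadic annuli
`r / 2 < 2 ^ k |x - x₀| < r`, and the `L^n` norm of a gradient is invariant under dilation, so that
`‖∇(φ N)‖_n ^ n` is at most a constant times `∑ 1 / (k + 1) ^ n`, which converges. -/
theorem exists_spikes (hn : 2 ≤ n) (x₀ : EuclideanSpace ℝ (Fin n)) {r : ℝ} (hr : 0 < r) :
    ∃ φ : ℕ → EuclideanSpace ℝ (Fin n) → ℝ, ∃ M : ℝ≥0∞, M ≠ ⊤ ∧ ∀ N,
      ContDiff ℝ ∞ (φ N) ∧ tsupport (φ N) ⊆ Metric.closedBall x₀ r ∧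
      eLpNorm (φ N) n volume ≤ M ∧ eLpNorm (fderiv ℝ (φ N)) n volume ≤ M ∧
      ∃ s, 0 < s ∧ s ≤ r ∧
        ∀ x ∈ Metric.ball x₀ s, ∑ k ∈ Finset.range N, 1 / ((k : ℝ) + 1) ≤ φ N x := by
  have : Nonempty (Fin n) := ⟨⟨0, by omega⟩⟩
  have hn0 : n ≠ 0 := by omega
  let b : ContDiffBump (0 : EuclideanSpace ℝ (Fin n)) := ⟨r / 2, r, half_pos hr, half_lt_self hr⟩
  obtain ⟨K, hK⟩ := (b.hasCompactSupport.fderiv ℝ).exists_bound_of_continuous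
    ((b.contDiff (n := ⊤)).continuous_fderiv (by simp))
  have hK0 : 0 ≤ K := (norm_nonneg _).trans (hK 0)
  let V : ℝ≥0∞ := volume (Metric.ball (0 : EuclideanSpace ℝ (Fin n)) 1)
  have hV : V ≠ ⊤ := measure_ball_lt_top.ne
  -- `ψ k` is supported in the ball of radius `ρ k` and constant on the one of radius `ρ (k + 1)`.
  let c : ℕ → ℝ := fun k => 1 / ((k : ℝ) + 1)
  have hc0 : ∀ k, 0 ≤ c k := fun k => by positivity
  have hc1 : ∀ k, c k ≤ 1 := fun k => by
    refine (div_le_one (by positivity)).2 ?_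
    have : (0 : ℝ) ≤ k := k.cast_nonneg
    linarith
  let ψ : ℕ → EuclideanSpace ℝ (Fin n) → ℝ := fun k x => c k * b ((2 : ℝ) ^ k • (x - x₀))
  let ρ : ℕ → ℝ := fun k => r / 2 ^ k
  have hρ0 : ∀ k, 0 < ρ k := fun k => by positivity
  have hout : ∀ k x, x ∉ Metric.ball x₀ (ρ k) → r ≤ ‖(2 : ℝ) ^ k • (x - x₀)‖ := fun k x hx => by
    rw [Metric.mem_ball, not_lt, dist_eq_norm] at hx
    rw [norm_smul, Real.norm_of_nonneg (by positivity), mul_comm]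
    exact (div_le_iff₀ (by positivity)).1 hx
  have hψs : ∀ k, ContDiff ℝ ∞ (ψ k) := fun k =>
    contDiff_const.mul (b.contDiff.comp ((contDiff_id.sub contDiff_const).const_smul _))
  have hψd : ∀ k x, fderiv ℝ (ψ k) x = (c k * 2 ^ k) • fderiv ℝ b ((2 : ℝ) ^ k • (x - x₀)) :=
    fun k x => by
      have h1 : HasFDerivAt (fun x : EuclideanSpace ℝ (Fin n) => (2 : ℝ) ^ k • (x - x₀))
          ((2 : ℝ) ^ k • ContinuousLinearMap.id ℝ (EuclideanSpace ℝ (Fin n))) x :=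
        ((hasFDerivAt_id x).sub_const x₀).const_smul ((2 : ℝ) ^ k)
      have h2 : HasFDerivAt b (fderiv ℝ b ((2 : ℝ) ^ k • (x - x₀))) ((2 : ℝ) ^ k • (x - x₀)) :=
        (((b.contDiff (n := ⊤)).differentiable (by simp)) _).hasFDerivAt
      have := ((h2.comp x h1).const_mul (c k)).fderiv
      simp only [Function.comp_def] at this
      rw [this, ContinuousLinearMap.comp_smul, ContinuousLinearMap.comp_id, smul_smul]
  have hψ0 : ∀ k x, 0 ≤ ψ k x := fun k x => mul_nonneg (hc0 k) b.nonneg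
  have hψout : ∀ k x, x ∉ Metric.ball x₀ (ρ k) → ψ k x = 0 := fun k x hx => by
    change c k * b _ = 0
    rw [b.zero_of_le_dist (by simpa using hout k x hx), mul_zero]
  have hψin : ∀ k x, x ∈ Metric.ball x₀ (ρ (k + 1)) → ψ k x = c k := fun k x hx => by
    change c k * b _ = c k
    rw [b.one_of_mem_closedBall, mul_one]
    rw [mem_closedBall_zero_iff, norm_smul, Real.norm_of_nonneg (by positivity)]
    rw [Metric.mem_ball, dist_eq_norm, lt_div_iff₀ (by positivity), pow_succ] at hx
    change 2 ^ k * ‖x - x₀‖ ≤ r / 2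
    linarith
  have hDout : ∀ k x, x ∉ Metric.ball x₀ (ρ k) → fderiv ℝ (ψ k) x = 0 := fun k x hx => by
    rw [hψd, b.fderiv_eq_zero_of_le_norm (hout k x hx), smul_zero]
  have hDin : ∀ k l x, k < l → x ∈ Metric.ball x₀ (ρ l) → fderiv ℝ (ψ k) x = 0 :=
    fun k l x hkl hx => by
      rw [hψd, b.fderiv_eq_zero_of_norm_le, smul_zero]
      rw [norm_smul, Real.norm_of_nonneg (by positivity)]
      rw [Metric.mem_ball, dist_eq_norm, lt_div_iff₀ (by positivity)] at hx
      have : (2 : ℝ) ^ (k + 1) ≤ 2 ^ l := pow_le_pow_right₀ one_le_two hkl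
      have h3 := mul_le_mul_of_nonneg_left this (norm_nonneg (x - x₀))
      rw [pow_succ] at h3
      change 2 ^ k * ‖x - x₀‖ ≤ r / 2
      linarith
  have hvol : ∀ k, volume (Metric.ball x₀ (ρ k)) = ENNReal.ofReal (ρ k ^ n) * V := fun k => by
    rw [Measure.addHaar_ball volume x₀ (hρ0 k).le]; simp [V]
  let φ : ℕ → EuclideanSpace ℝ (Fin n) → ℝ := fun N x => ∑ k ∈ Finset.range N, ψ k x
  have hφd : ∀ N x, fderiv ℝ (φ N) x = ∑ k ∈ Finset.range N, fderiv ℝ (ψ k) x := fun N x =>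
    fderiv_fun_sum fun k _ => (hψs k).differentiable (by simp) x
  let S : ℝ := ∑' k : ℕ, c k ^ 2
  have hsum : Summable fun k : ℕ => c k ^ 2 := by
    have := (summable_nat_add_iff 1).2 (Real.summable_one_div_nat_pow.2 one_lt_two)
    refine this.congr fun k => ?_
    simp only [c]
    push_cast
    rw [div_pow, one_pow]
  let M1 : ℝ≥0∞ := (ENNReal.ofReal (S * (K * r) ^ n) * V) ^ (1 / (n : ℝ))
  let M2 : ℝ≥0∞ := ENNReal.ofReal (2 * r) * V ^ (1 / (n : ℝ))
  have hM1 : M1 ≠ ⊤ := ENNReal.rpow_ne_top_of_nonneg (by positivity)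
    (ENNReal.mul_ne_top ENNReal.ofReal_ne_top hV)
  have hM2 : M2 ≠ ⊤ := ENNReal.mul_ne_top ENNReal.ofReal_ne_top
    (ENNReal.rpow_ne_top_of_nonneg (by positivity) hV)
  have hz : ‖(0 : EuclideanSpace ℝ (Fin n) →L[ℝ] ℝ)‖ₑ = 0 := by
    rw [← ofReal_norm, norm_zero, ENNReal.ofReal_zero]
  have hgrad : ∀ N, eLpNorm (fderiv ℝ (φ N)) n volume ≤ M1 := fun N => by
    refine (eLpNorm_natCast_le_of_forall_enorm_pow_le_sum hn0 (Finset.range N)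
      (fun k => Metric.ball x₀ (ρ k)) (fun k _ => measurableSet_ball)
      (fun k => ENNReal.ofReal ((c k * 2 ^ k * K) ^ n)) fun x => ?_).trans ?_
    · have hterm : ∀ k, ‖fderiv ℝ (ψ k) x‖ₑ ^ n ≤ (Metric.ball x₀ (ρ k)).indicator
          (fun _ => ENNReal.ofReal ((c k * 2 ^ k * K) ^ n)) x := fun k => by
        by_cases hx : x ∈ Metric.ball x₀ (ρ k)
        · rw [Set.indicator_of_mem hx, ENNReal.ofReal_pow
            (mul_nonneg (mul_nonneg (hc0 k) (by positivity)) hK0), ← ofReal_norm]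
          gcongr
          rw [hψd, norm_smul, Real.norm_of_nonneg (mul_nonneg (hc0 k) (by positivity))]
          exact mul_le_mul_of_nonneg_left (hK _) (mul_nonneg (hc0 k) (by positivity))
        · rw [hDout k x hx, hz, zero_pow hn0]
          exact zero_le
      rw [hφd]
      -- At most one summand has a nonzero gradient at `x`.
      by_cases hex : ∃ k ∈ Finset.range N, fderiv ℝ (ψ k) x ≠ 0
      · obtain ⟨k, hk, hkx⟩ := hex
        rw [Finset.sum_eq_single_of_mem k hk]
        · exact (hterm k).trans (Finset.single_le_sum (f := fun k => (Metric.ball x₀ (ρ k)).indicator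
            (fun _ => ENNReal.ofReal ((c k * 2 ^ k * K) ^ n)) x) (fun _ _ => zero_le) hk)
        · intro l _ hlk
          by_contra hl
          have hxk : x ∈ Metric.ball x₀ (ρ k) := by_contra fun h => hkx (hDout k x h)
          have hxl : x ∈ Metric.ball x₀ (ρ l) := by_contra fun h => hl (hDout l x h)
          rcases lt_or_gt_of_ne hlk with h | h
          · exact hl (hDin l k x h hxk)
          · exact hkx (hDin k l x h hxl)
      · push Not at hex
        rw [Finset.sum_eq_zero hex, hz, zero_pow hn0]
        exact zero_le
    · change _ ≤ (ENNReal.ofReal (S * (K * r) ^ n) * V) ^ (1 / (n : ℝ))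
      gcongr
      have h1 : ∀ k, ENNReal.ofReal ((c k * 2 ^ k * K) ^ n) * volume (Metric.ball x₀ (ρ k))
          ≤ ENNReal.ofReal (c k ^ 2 * (K * r) ^ n) * V := fun k => by
        have h0 : 0 ≤ c k * 2 ^ k * K := mul_nonneg (mul_nonneg (hc0 k) (by positivity)) hK0
        rw [hvol, ← mul_assoc, ← ENNReal.ofReal_mul (pow_nonneg h0 n), ← mul_pow]
        gcongr
        have h2 : c k * 2 ^ k * K * ρ k = c k * (K * r) := by
          simp only [ρ]; field_simp
        rw [h2, mul_pow]
        exact mul_le_mul_of_nonneg_right (pow_le_pow_of_le_one (hc0 k) (hc1 k) hn) (by positivity)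
      refine (Finset.sum_le_sum fun k _ => h1 k).trans ?_
      rw [← Finset.sum_mul, ← ENNReal.ofReal_sum_of_nonneg fun k _ => by positivity,
        ← Finset.sum_mul]
      gcongr
      exact hsum.sum_le_tsum _ fun k _ => sq_nonneg _
  have hval : ∀ N, eLpNorm (φ N) n volume ≤ M2 := fun N => by
    have h1 : ∀ k, eLpNorm (ψ k) n volume ≤ ENNReal.ofReal (ρ k) * V ^ (1 / (n : ℝ)) := fun k => by
      refine (eLpNorm_natCast_le_of_forall_enorm_pow_le_sum hn0 {k}
        (fun k => Metric.ball x₀ (ρ k)) (fun k _ => measurableSet_ball) (fun _ => 1)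
        fun x => ?_).trans ?_
      · rw [Finset.sum_singleton]
        by_cases hx : x ∈ Metric.ball x₀ (ρ k)
        · rw [Set.indicator_of_mem hx]
          refine pow_le_one₀ zero_le ?_
          rw [Real.enorm_of_nonneg (hψ0 k x), ENNReal.ofReal_le_one]
          exact mul_le_one₀ (hc1 k) b.nonneg b.le_one
        · rw [hψout k x hx]; simp [hn0]
      · rw [Finset.sum_singleton, one_mul, hvol, ENNReal.mul_rpow_of_nonneg _ _ (by positivity),
          ENNReal.ofReal_pow (hρ0 k).le, ← ENNReal.rpow_natCast, ← ENNReal.rpow_mul,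
          mul_one_div_cancel (by exact_mod_cast hn0), ENNReal.rpow_one]
    have hφ : φ N = ∑ k ∈ Finset.range N, ψ k := by
      ext x; simp [φ]
    rw [hφ]
    refine (eLpNorm_sum_le (fun k _ => (hψs k).continuous.aestronglyMeasurable)
      (by exact_mod_cast (by omega : 1 ≤ n))).trans ?_
    refine (Finset.sum_le_sum fun k _ => h1 k).trans ?_
    rw [← Finset.sum_mul, ← ENNReal.ofReal_sum_of_nonneg fun k _ => (hρ0 k).le]
    change _ ≤ ENNReal.ofReal (2 * r) * V ^ (1 / (n : ℝ))
    gcongr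
    have hg : HasSum (fun k => r * (1 / 2 : ℝ) ^ k) (r * 2) := hasSum_geometric_two.mul_left r
    have h3 : ∀ k, ρ k = r * (1 / 2 : ℝ) ^ k := fun k => by
      simp [ρ, div_eq_mul_inv]
    simp only [h3]
    rw [mul_comm 2 r]
    exact sum_le_hasSum _ (fun k _ => by positivity) hg
  refine ⟨φ, max M1 M2, (max_lt hM1.lt_top hM2.lt_top).ne, fun N =>
    ⟨ContDiff.sum fun k _ => hψs k, ?_, (hval N).trans (le_max_right _ _),
      (hgrad N).trans (le_max_left _ _), ρ N, hρ0 N, ?_, fun x hx => ?_⟩⟩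
  · refine closure_minimal (fun x hx => ?_) Metric.isClosed_closedBall
    by_contra hxr
    refine hx (Finset.sum_eq_zero fun k _ => hψout k x fun h => hxr ?_)
    refine (Metric.ball_subset_closedBall.trans (Metric.closedBall_subset_closedBall ?_)) h
    exact div_le_self hr.le (one_le_pow₀ one_le_two)
  · exact div_le_self hr.le (one_le_pow₀ one_le_two)
  · refine Finset.sum_le_sum fun k hk => ?_
    rw [hψin k x]
    refine Metric.ball_subset_ball ?_ hx
    exact div_le_div_of_nonneg_left hr.le (by positivity)
      (pow_le_pow_right₀ one_le_two (Finset.mem_range.1 hk))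

end Spikes

/-! ### The a priori estimate satisfied by every solvable right-hand side -/

section Estimate

open Filter Topology ContDiff

theorem enorm_integral_mul_le_eLpNorm_mul_eLpNorm {α : Type*} [MeasurableSpace α] {μ : Measure α}
    {p q : ℝ≥0∞} [p.HolderConjugate q] {f g : α → ℝ} (hf : AEStronglyMeasurable f μ)
    (hg : AEStronglyMeasurable g μ) :
    ‖∫ x, f x * g x ∂μ‖ₑ ≤ eLpNorm f p μ * eLpNorm g q μ := by
  refine (enorm_integral_le_lintegral_enorm _).trans ?_
  have := eLpNorm_smul_le_mul_eLpNorm (r := 1) (p := p) (q := q) hg hf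
  rwa [eLpNorm_one_eq_lintegral_enorm] at this

/-- A bounded measurable function acts on `L¹` as a continuous linear functional. -/
theorem exists_clm_integral_mul {α : Type*} [MeasurableSpace α] (μ : Measure α)
    {φ : α → ℝ} (hφ : AEStronglyMeasurable φ μ) {K : ℝ} (hK : ∀ x, ‖φ x‖ ≤ K) :
    ∃ T : Lp ℝ 1 μ →L[ℝ] ℝ, ∀ f : Lp ℝ 1 μ, T f = ∫ x, f x * φ x ∂μ := by
  have hi : ∀ f : Lp ℝ 1 μ, Integrable (fun x => f x * φ x) μ := fun f =>
    (L1.integrable_coeFn f).mul_bdd hφ (ae_of_all _ hK)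
  refine ⟨LinearMap.mkContinuous
    { toFun := fun f => ∫ x, f x * φ x ∂μ
      map_add' := fun f g => ?_
      map_smul' := fun c f => ?_ } K fun f => ?_, fun f => rfl⟩
  · rw [← integral_add (hi f) (hi g)]
    refine integral_congr_ae ?_
    filter_upwards [Lp.coeFn_add f g] with x hx
    rw [hx, Pi.add_apply, add_mul]
  · rw [RingHom.id_apply, ← integral_smul]
    refine integral_congr_ae ?_
    filter_upwards [Lp.coeFn_smul c f] with x hx
    rw [hx, Pi.smul_apply, smul_mul_assoc]
  · change ‖∫ x, f x * φ x ∂μ‖ ≤ K * ‖f‖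
    rw [L1.norm_eq_integral_norm, ← integral_const_mul]
    refine norm_integral_le_of_norm_le ((L1.integrable_coeFn f).norm.const_mul K)
      (ae_of_all _ fun x => ?_)
    rw [norm_mul, mul_comm]
    exact mul_le_mul_of_nonneg_right (hK x) (norm_nonneg _)

variable {n : ℕ}

theorem memLp_inner_of_memLp_top {α : Type*} [MeasurableSpace α] {μ : Measure α} {p : ℝ≥0∞}
    {a u : α → EuclideanSpace ℝ (Fin n)} (ha : MemLp a ⊤ μ)
    (hu : ∀ i, MemLp (fun x => u x i) p μ) : MemLp (fun x => inner ℝ (a x) (u x)) p μ := by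
  have h : ∀ i, MemLp (fun x => a x i * u x i) p μ := fun i => by
    have hai : MemLp (fun x => a x i) ⊤ μ :=
      ha.of_le ((EuclideanSpace.proj (𝕜 := ℝ) i).continuous.comp_aestronglyMeasurable
        ha.aestronglyMeasurable) (ae_of_all _ fun x => PiLp.norm_apply_le (a x) i)
    exact (hu i).mul' hai
  have := memLp_finsetSum Finset.univ fun i _ => h i
  refine this.ae_eq (ae_of_all _ fun x => ?_)
  simp [PiLp.inner_apply, mul_comm]

/-- Integrating the equation by parts against a test function `φ` supported in a compact set `B`
bounds `∫ f φ` by `‖∇φ‖_n + ‖φ‖_n`, with a constant which depends on `u` but not on `φ`. The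
exponent `q` is the conjugate of the dimension. -/
theorem SolvesPerturbedDivEq.enorm_integral_mul_le {Ω : Opens (EuclideanSpace ℝ (Fin n))}
    {a u : EuclideanSpace ℝ (Fin n) → EuclideanSpace ℝ (Fin n)}
    {f : EuclideanSpace ℝ (Fin n) → ℝ} (hs : SolvesPerturbedDivEq Ω a f u)
    {q : ℝ≥0∞} (hq1 : 1 ≤ q) [q.HolderConjugate n]
    {B : Set (EuclideanSpace ℝ (Fin n))} (hB : IsCompact B)
    (hBΩ : B ⊆ Ω) (hu : ∀ i, MemLp (fun x => u x i) q (volume.restrict B))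
    (hau : MemLp (fun x => inner ℝ (a x) (u x)) q (volume.restrict B))
    {φ : EuclideanSpace ℝ (Fin n) → ℝ} (hφ : ContDiff ℝ ∞ φ) (hφB : tsupport φ ⊆ B) :
    ‖∫ x in (Ω : Set (EuclideanSpace ℝ (Fin n))), f x * φ x‖ₑ
      ≤ (∑ i, eLpNorm (fun x => u x i) q (volume.restrict B)) * eLpNorm (fderiv ℝ φ) n volume
        + eLpNorm (fun x => inner ℝ (a x) (u x)) q (volume.restrict B) * eLpNorm φ n volume := by
  obtain ⟨D, hD, hDf⟩ := hs
  have hφc : HasCompactSupport φ := hB.of_isClosed_subset (isClosed_tsupport φ) hφB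
  let dφ : Fin n → EuclideanSpace ℝ (Fin n) → ℝ := fun i x =>
    fderiv ℝ φ x (EuclideanSpace.single i 1)
  have hdφ : ∀ i, Continuous (dφ i) := fun i =>
    (hφ.continuous_fderiv (by simp)).clm_apply continuous_const
  have hφ0 : ∀ x ∉ B, φ x = 0 := fun x hx =>
    image_eq_zero_of_notMem_tsupport fun h => hx (hφB h)
  have hdφ0 : ∀ i, ∀ x ∉ B, dφ i x = 0 := fun i x hx =>
    image_eq_zero_of_notMem_tsupport fun h =>
      hx (hφB (tsupport_fderiv_apply_subset ℝ (EuclideanSpace.single i (1 : ℝ)) h))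
  have hset : ∀ g ψ : EuclideanSpace ℝ (Fin n) → ℝ, (∀ x ∉ B, ψ x = 0) →
      ∫ x in (Ω : Set (EuclideanSpace ℝ (Fin n))), g x * ψ x = ∫ x in B, g x * ψ x :=
    fun g ψ hψ => by
      rw [setIntegral_eq_integral_of_forall_compl_eq_zero fun x hx => by
          rw [hψ x fun h => hx (hBΩ h), mul_zero],
        setIntegral_eq_integral_of_forall_compl_eq_zero fun x hx => by rw [hψ x hx, mul_zero]]
  have hparts : ∀ i, ∫ x in B, D x i i * φ x = - ∫ x in B, u x i * dφ i x := fun i => by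
    have := (hD i i).2.2 ⟨φ, hφ, hφc, hφB.trans hBΩ⟩
    simp only [TestFunction.coe_mk] at this
    rw [← hset _ _ hφ0, ← hset _ _ (hdφ0 i), this, neg_neg]
  obtain ⟨K, hK⟩ := hφc.exists_bound_of_continuous hφ.continuous
  have hDi : ∀ i, Integrable (fun x => D x i i * φ x) (volume.restrict B) := fun i =>
    (((hD i i).2.1.integrableOn_compact_subset hBΩ hB)).mul_bdd
      hφ.continuous.aestronglyMeasurable (ae_of_all _ hK)
  have : IsFiniteMeasure (volume.restrict B) := ⟨by
    rw [Measure.restrict_apply_univ]; exact hB.measure_lt_top⟩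
  have haui : Integrable (fun x => inner ℝ (a x) (u x) * φ x) (volume.restrict B) :=
    (hau.integrable hq1).mul_bdd hφ.continuous.aestronglyMeasurable (ae_of_all _ hK)
  have heq : ∫ x in (Ω : Set (EuclideanSpace ℝ (Fin n))), f x * φ x
      = (∑ i, - ∫ x in B, u x i * dφ i x) + ∫ x in B, inner ℝ (a x) (u x) * φ x := by
    rw [hset f φ hφ0, ← Finset.sum_congr rfl fun i _ => hparts i,
      ← integral_finsetSum _ fun i _ => hDi i,
      ← integral_add (integrable_finsetSum _ fun i _ => hDi i) haui]
    refine integral_congr_ae ?_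
    filter_upwards [ae_restrict_of_ae_restrict_of_subset hBΩ hDf] with x hx
    rw [← hx, Matrix.trace, add_mul, Finset.sum_mul]
    rfl
  rw [heq, Finset.sum_mul]
  refine (enorm_add_le _ _).trans (add_le_add ((enorm_sum_le _ _).trans
    (Finset.sum_le_sum fun i _ => ?_)) ?_)
  · rw [enorm_neg]
    refine (enorm_integral_mul_le_eLpNorm_mul_eLpNorm (p := q) (q := n)
      (hu i).aestronglyMeasurable (hdφ i).aestronglyMeasurable).trans ?_
    gcongr
    refine (eLpNorm_mono_measure _ Measure.restrict_le_self).trans (eLpNorm_mono fun x => ?_)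
    simpa using (fderiv ℝ φ x).le_opNorm (EuclideanSpace.single i (1 : ℝ))
  · refine (enorm_integral_mul_le_eLpNorm_mul_eLpNorm (p := q) (q := n)
      hau.aestronglyMeasurable hφ.continuous.aestronglyMeasurable).trans ?_
    gcongr
    exact Measure.restrict_le_self

end Estimate

/-! ### Non-surjectivity -/

theorem theorem4p1 (n : ℕ) (hn : 2 ≤ n)
    (Ω : Opens (EuclideanSpace ℝ (Fin n)))
    (hne : (Ω : Set (EuclideanSpace ℝ (Fin n))).Nonempty)
    (hbdd : Bornology.IsBounded (Ω : Set (EuclideanSpace ℝ (Fin n))))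
    (hLip : IsLipschitzSet Ω)
    (a : EuclideanSpace ℝ (Fin n) → EuclideanSpace ℝ (Fin n))
    (ha : MemLp a ∞ (volume.restrict (Ω : Set (EuclideanSpace ℝ (Fin n))))) :
    ∃ f : EuclideanSpace ℝ (Fin n) → ℝ,
      MemLp f 1 (volume.restrict (Ω : Set (EuclideanSpace ℝ (Fin n)))) ∧
      ¬ ∃ u : EuclideanSpace ℝ (Fin n) → EuclideanSpace ℝ (Fin n),
        MemSobolevOne Ω 1 u ∧ SolvesPerturbedDivEq Ω a f u := by
  by_contra! hcon
  obtain ⟨x₀, hx₀⟩ := hne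
  obtain ⟨ε, hε, hεΩ⟩ := Metric.nhds_basis_closedBall.mem_iff.1 (Ω.isOpen.mem_nhds hx₀)
  obtain ⟨r, rfl⟩ : ∃ r, ε = 2 * r := ⟨ε / 2, by ring⟩
  have hr : 0 < r := by linarith
  have hBΩ : Metric.closedBall x₀ r ⊆ (Ω : Set (EuclideanSpace ℝ (Fin n))) :=
    (Metric.closedBall_subset_closedBall (by linarith)).trans hεΩ
  obtain ⟨φ, M, hM, hφ⟩ := exists_spikes hn x₀ hr
  have hn1 : (1 : NNReal) < n := by exact_mod_cast (by omega : 1 < n)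
  have hconj := NNReal.HolderConjugate.conjExponent hn1
  set q : NNReal := (n : NNReal).conjExponent
  have : (q : ℝ≥0∞).HolderConjugate n := by
    have := hconj.symm.coe_ennreal
    simpa using this
  have hq1 : (1 : ℝ≥0∞) ≤ q := by exact_mod_cast hconj.symm.lt.le
  have hcomp : ∀ N, HasCompactSupport (φ N) := fun N =>
    (isCompact_closedBall x₀ r).of_isClosed_subset (isClosed_tsupport _) (hφ N).2.1
  choose K hK using fun N =>
    (hcomp N).exists_bound_of_continuous (hφ N).1.continuous
  choose T hT using fun N =>
    exists_clm_integral_mul (volume.restrict (Ω : Set (EuclideanSpace ℝ (Fin n))))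
      (hφ N).1.continuous.aestronglyMeasurable (hK N)
  -- Pointwise boundedness of the functionals: a solution `u` for the right-hand side `f` is in
  -- `L^q` near `x₀`, so the estimate above is uniform in `N`.
  obtain ⟨C, hC⟩ : ∃ C, ∀ N, ‖T N‖ ≤ C := by
    refine banach_steinhaus fun f => ?_
    obtain ⟨u, -, hu⟩ := hcon f (Lp.memLp f)
    have hui : ∀ i, MemLp (fun x => u x i) q (volume.restrict (Metric.closedBall x₀ r)) := by
      obtain ⟨D, hD, -⟩ := hu
      exact fun i => memLp_restrict_ball hconj (hD i) (hD i i).1 hr hεΩ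
    have hau := memLp_inner_of_memLp_top (ha.mono_measure (Measure.restrict_mono_set _ hBΩ)) hui
    let R : ℝ≥0∞ :=
      (∑ i, eLpNorm (fun x => u x i) q (volume.restrict (Metric.closedBall x₀ r))) * M +
      eLpNorm (fun x => inner ℝ (a x) (u x)) q (volume.restrict (Metric.closedBall x₀ r)) * M
    have hR : R ≠ ∞ := ENNReal.add_ne_top.2
      ⟨ENNReal.mul_ne_top (ENNReal.sum_ne_top.2 fun i _ => (hui i).eLpNorm_ne_top) hM,
        ENNReal.mul_ne_top hau.eLpNorm_ne_top hM⟩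
    refine ⟨R.toReal, fun N => ?_⟩
    rw [hT, ← toReal_enorm]
    refine ENNReal.toReal_mono hR ((hu.enorm_integral_mul_le hq1 (isCompact_closedBall x₀ r) hBΩ
      hui hau (hφ N).1 (hφ N).2.1).trans ?_)
    exact add_le_add (mul_le_mul_right (hφ N).2.2.2.1 _) (mul_le_mul_right (hφ N).2.2.1 _)
  -- Testing `T N` on the indicator of a ball on which `φ N` is at least the `N`-th harmonic number.
  have hharm : ∀ N : ℕ, ∑ k ∈ Finset.range N, 1 / ((k : ℝ) + 1) ≤ C := fun N => by
    obtain ⟨s, hs, hsr, hsN⟩ := (hφ N).2.2.2.2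
    have hbΩ : Metric.ball x₀ s ⊆ (Ω : Set (EuclideanSpace ℝ (Fin n))) :=
      (Metric.ball_subset_closedBall.trans (Metric.closedBall_subset_closedBall hsr)).trans hBΩ
    have hμ : (volume.restrict (Ω : Set (EuclideanSpace ℝ (Fin n)))) (Metric.ball x₀ s)
        = volume (Metric.ball x₀ s) := Measure.restrict_eq_self _ hbΩ
    have hμt : (volume.restrict (Ω : Set (EuclideanSpace ℝ (Fin n)))) (Metric.ball x₀ s) ≠ ∞ := by
      rw [hμ]; exact measure_ball_lt_top.ne
    have hpos : 0 < volume.real (Metric.ball x₀ s) :=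
      ENNReal.toReal_pos (Metric.measure_ball_pos volume x₀ hs).ne' measure_ball_lt_top.ne
    have h1 := (T N).le_of_opNorm_le (hC N)
      (indicatorConstLp 1 (measurableSet_ball (x := x₀) (ε := s)) hμt (1 : ℝ))
    rw [norm_indicatorConstLp one_ne_zero ENNReal.one_ne_top, hT] at h1
    have h2 : ∫ x in (Ω : Set (EuclideanSpace ℝ (Fin n))),
        (indicatorConstLp 1 (measurableSet_ball (x := x₀) (ε := s)) hμt (1 : ℝ)) x * φ N x
        = ∫ x in Metric.ball x₀ s, φ N x := by
      rw [← integral_indicator measurableSet_ball, ← setIntegral_eq_integral_of_forall_compl_eq_zero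
        (s := (Ω : Set (EuclideanSpace ℝ (Fin n)))) fun x hx =>
          Set.indicator_of_notMem (fun h => hx (hbΩ h)) _]
      refine integral_congr_ae ?_
      filter_upwards [indicatorConstLp_coeFn (p := 1) (hs := measurableSet_ball (x := x₀) (ε := s))
        (hμs := hμt) (c := (1 : ℝ))] with x hx
      rw [hx]
      by_cases h : x ∈ Metric.ball x₀ s <;> simp [h]
    have h3 : (∑ k ∈ Finset.range N, 1 / ((k : ℝ) + 1)) * volume.real (Metric.ball x₀ s)
        ≤ ∫ x in Metric.ball x₀ s, φ N x :=
      setIntegral_ge_of_const_le_real measurableSet_ball measure_ball_lt_top.ne hsN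
        ((hφ N).1.continuous.integrable_of_hasCompactSupport (hcomp N)).integrableOn
    rw [h2] at h1
    have h4 := h3.trans ((le_abs_self _).trans h1)
    refine le_of_mul_le_mul_right (h4.trans_eq ?_) hpos
    simp [Measure.real, hμ]
  obtain ⟨N, hN⟩ := (Real.tendsto_sum_range_one_div_nat_succ_atTop.eventually_gt_atTop C).exists
  exact (hharm N).not_gt hN
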